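/- Let $k$ be a field and let $G$ be a finite simple graph with vertex set $V$. Call $G$ an HL-comparability graph if there is a partial order $P$ on $V$ such that (i) distinct $i,j\in V$ are adjacent in $G$ if and only if $i\le j$ or $j\le i$ in $P$, and (ii) $P$ does not contain the X-poset as an (induced) subposet, that is, there are no $a,b,c,d,e\in V$ with $a<c$, $b<c$, $c<d$, $c<e$, with $a,b$ incomparable and with $d,e$ incomparable. Let $\mathcal Q_G\subset\mathbb R^V$ be the stable set polytope of $G$, i.e. the convex hull of the vectors $\rho(S)=\sum_{i\in S}\mathbf e_i$, where $S$ ranges over the stable (independent) sets of $G$, including $\emptyset$. Let $$k[\mathcal Q_G]=k\Big[\,T\cdot\prod_{v\in V}X_v^{a_v}\ \Big|\ (a_v)_{v\in V}\text{ is a vertex of }\mathcal Q_G\Big]\subset k[T,X_v: v\in V],$$ graded by giving each generator $T\cdot\prod_v X_v^{a_v}$ degree $1$. Theorem. If $G$ is an HL-comparability graph, then $R=k[\mathcal Q_G]$ is Koszul; that is, with $\mathfrak m=R_+$, the residue field $k=R/\mathfrak m$ has a linear resolution over $R$: there is an exact sequence $$\cdots\to R(-2)^{b_2}\to R(-1)^{b_1}\to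 R^{b_0}\to R/\mathfrak m\to 0$$ of graded $R$-modules and homomorphisms of degree $0$, with $b_0,b_1,\dots$ natural numbers. -/

import Mathlib

/-! ### Graded modules with a linear resolution and Koszul algebras -/

/-- Let `R = ⨁ₙ 𝒜 n` be a graded commutative `k`-algebra and `M = ⨁ₙ ℳ n` a graded `R`-module.
`M` has a (`0`-)linear resolution if there is an exact sequence
`⋯ ⟶ R(-2)^{b 2} ⟶ R(-1)^{b 1} ⟶ R^{b 0} ⟶ M ⟶ 0`
of graded free `R`-modules and `R`-linear maps of degree `0`. Since the basis of the `i`-th free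
module sits in degree `i`, that the maps have degree `0` says that `R^{b 0} ⟶ M` sends the basis
into `ℳ 0` and that all entries of the matrices of the differentials `d i` lie in `𝒜 1`. -/
def HasLinearResolution {k R M : Type*} [Field k] [CommRing R] [Algebra k R]
    [AddCommGroup M] [Module k M] [Module R M]
    (𝒜 : ℕ → Submodule k R) (ℳ : ℕ → Submodule k M) : Prop :=
  ∃ (b : ℕ → ℕ) (d : ∀ i, (Fin (b (i + 1)) → R) →ₗ[R] (Fin (b i) → R))
    (ε : (Fin (b 0) → R) →ₗ[R] M),
    (∀ j, ε (Pi.single j 1) ∈ ℳ 0) ∧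
    (∀ i j l, d i (Pi.single j 1) l ∈ 𝒜 1) ∧
    Function.Surjective ε ∧
    Function.Exact (d 0) ε ∧
    ∀ i, Function.Exact (d (i + 1)) (d i)

/-- The grading induced on `R ⧸ I` by a grading `𝒜` of `R`. -/
def quotientGrading {k R : Type*} [Field k] [CommRing R] [Algebra k R]
    (𝒜 : ℕ → Submodule k R) (I : Ideal R) (n : ℕ) : Submodule k (R ⧸ I) :=
  (𝒜 n).map (Ideal.Quotient.mkₐ k I).toLinearMap

/-- A (nonzero, commutative, connected) graded `k`-algebra `R = ⨁ₙ 𝒜 n`, `𝒜 0 = k`, is Koszul if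
the residue class field `k = R ⧸ 𝔪`, with `𝔪 = R₊ = ⨁_{n > 0} 𝒜 n`, has a linear resolution
over `R`. -/
def IsKoszul {k R : Type*} [Field k] [CommRing R] [Algebra k R]
    (𝒜 : ℕ → Submodule k R) [GradedAlgebra 𝒜] : Prop :=
  Nontrivial R ∧ 𝒜 0 = 1 ∧
    HasLinearResolution 𝒜 (quotientGrading 𝒜 (HomogeneousIdeal.irrelevant 𝒜).toIdeal)

/-! ### The toric ring of a polytope -/

section ToricRing

variable (k : Type*) [Field k] {V : Type*} [Fintype V]

/-- The monomial `T · ∏ᵥ Xᵥ ^ aᵥ` in `k[T, Xᵥ : v ∈ V]`; the variable `T` is indexed by `none`,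
and `Xᵥ` by `some v`. -/
noncomputable def toricMonomial (a : V → ℕ) : MvPolynomial (Option V) k :=
  MvPolynomial.X none * ∏ v, MvPolynomial.X (some v) ^ a v

/-- The toric ring `k[P] = k[T · ∏ᵥ Xᵥ ^ aᵥ | a is a vertex of P]` of an integral convex polytope
`P` in `ℝ^V` all of whose vertices have nonnegative coordinates. -/
noncomputable def toricRing (P : Set (V → ℝ)) : Subalgebra k (MvPolynomial (Option V) k) :=
  Algebra.adjoin k
    {m | ∃ a : V → ℕ, (fun v => (a v : ℝ)) ∈ P.extremePoints ℝ ∧ m = toricMonomial k a}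

/-- The weight that gives `T` degree `1` and every `Xᵥ` degree `0`. -/
def toricWeight (V : Type*) : Option V → ℕ := fun o => o.elim 1 (fun _ => 0)

/-- The grading of `k[P]` by the degree in `T`: it gives each generator `T · ∏ᵥ Xᵥ ^ aᵥ`
degree `1`. -/
noncomputable def toricGrading (P : Set (V → ℝ)) (n : ℕ) : Submodule k (toricRing k P) :=
  (MvPolynomial.weightedHomogeneousSubmodule k (toricWeight V) n).comap
    (toricRing k P).val.toLinearMap

lemma mem_toricGrading (P : Set (V → ℝ)) (n : ℕ) (x : toricRing k P) :
    x ∈ toricGrading k P n ↔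
      MvPolynomial.IsWeightedHomogeneous (toricWeight V) (x : MvPolynomial (Option V) k) n :=
  Iff.rfl

lemma toricMonomial_isWeightedHomogeneous (a : V → ℕ) :
    MvPolynomial.IsWeightedHomogeneous (toricWeight V) (toricMonomial k a) 1 := by
  have h := MvPolynomial.isWeightedHomogeneous_X k (toricWeight V) none
  have h2 : MvPolynomial.IsWeightedHomogeneous (toricWeight V)
      (∏ v, (MvPolynomial.X (some v) : MvPolynomial (Option V) k) ^ a v) (∑ _v : V, 0) := by
    refine MvPolynomial.IsWeightedHomogeneous.prod _ _ _ fun v _ => ?_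
    simpa [toricWeight] using
      (MvPolynomial.isWeightedHomogeneous_X k (toricWeight V) (some v)).pow (a v)
  simpa [toricWeight, toricMonomial] using h.mul h2

instance toricGrading_gradedMonoid (P : Set (V → ℝ)) :
    SetLike.GradedMonoid (toricGrading k P) where
  one_mem := MvPolynomial.isWeightedHomogeneous_one k (toricWeight V)
  mul_mem _ _ _ _ hx hy := MvPolynomial.IsWeightedHomogeneous.mul hx hy

lemma weightedHomogeneousComponent_coeAddMonoidHom (P : Set (V → ℝ)) (i : ℕ)
    (x : DirectSum ℕ fun n => toricGrading k P n) :
    MvPolynomial.weightedHomogeneousComponent (toricWeight V) i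
      ((DirectSum.coeAddMonoidHom (toricGrading k P) x : toricRing k P) :
        MvPolynomial (Option V) k) = ((x i : toricRing k P) : MvPolynomial (Option V) k) := by
  classical
  induction x using DirectSum.induction_on with
  | zero => simp
  | of j y =>
    rw [DirectSum.coeAddMonoidHom_of]
    by_cases hij : j = i
    · subst hij
      rw [DirectSum.of_eq_same]
      exact MvPolynomial.IsWeightedHomogeneous.weightedHomogeneousComponent_same
        ((mem_toricGrading k P j y).1 y.2)
    · rw [DirectSum.of_eq_of_ne _ _ _ (Ne.symm hij)]
      exact MvPolynomial.IsWeightedHomogeneous.weightedHomogeneousComponent_ne _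
        ((mem_toricGrading k P j y).1 y.2) (by tauto)
  | add a b ha hb => simp [ha, hb]

lemma mem_of_toricGrading_one_le (P : Set (V → ℝ)) (B : Subalgebra k (toricRing k P))
    (hB : ∀ y : toricRing k P, y ∈ toricGrading k P 1 → y ∈ B) (x : toricRing k P) : x ∈ B := by
  have h : toricRing k P ≤ B.map (toricRing k P).val := by
    refine Algebra.adjoin_le fun y hy => ?_
    refine ⟨⟨y, Algebra.subset_adjoin hy⟩, hB _ ?_, rfl⟩
    obtain ⟨a, -, rfl⟩ := hy
    exact toricMonomial_isWeightedHomogeneous k a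
  obtain ⟨y, hy, hyx⟩ := h x.2
  rwa [← Subtype.ext hyx]

lemma toricGrading_isInternal (P : Set (V → ℝ)) :
    DirectSum.IsInternal (toricGrading k P) := by
  constructor
  · intro x y hxy
    ext i : 1
    apply Subtype.ext
    apply Subtype.ext
    rw [← weightedHomogeneousComponent_coeAddMonoidHom,
      ← weightedHomogeneousComponent_coeAddMonoidHom, hxy]
  · intro x
    obtain ⟨y, hy⟩ := mem_of_toricGrading_one_le k P
      (DirectSum.coeAlgHom (toricGrading k P)).range
      (fun y hy => ⟨DirectSum.of (fun i => toricGrading k P i) 1 ⟨y, hy⟩,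
        DirectSum.coeAlgHom_of _ _ _⟩) x
    exact ⟨y, hy⟩

noncomputable instance toricGrading_gradedAlgebra (P : Set (V → ℝ)) :
    GradedAlgebra (toricGrading k P) where
  toDecomposition := (toricGrading_isInternal k P).chooseDecomposition

end ToricRing

/-! ### Stable set polytopes and HL-comparability graphs -/

/-- The stable set polytope `𝒬_G` of `G`: the convex hull in `ℝ^V` of the vectors
`ρ(S) = ∑_{i ∈ S} eᵢ`, where `S` ranges over the stable (independent) sets of `G`. -/
noncomputable def stableSetPolytope {V : Type*} (G : SimpleGraph V) : Set (V → ℝ) :=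
  convexHull ℝ {x | ∃ S : Set V, G.IsIndepSet S ∧ x = S.indicator (fun _ => (1 : ℝ))}

/-- `G` is the comparability graph of the partial order `P` on its vertex set. -/
def IsComparabilityGraphOf {V : Type*} (G : SimpleGraph V) (P : PartialOrder V) : Prop :=
  ∀ i j : V, G.Adj i j ↔ i ≠ j ∧ (P.le i j ∨ P.le j i)

/-- The X-poset: five elements `a, b, c, d, e` with `a < c`, `b < c`, `c < d`, `c < e`, in which
`a, b` are incomparable and `d, e` are incomparable. It appears as an (induced) subposet of `P`. -/
def HasXSubposet {V : Type*} (P : PartialOrder V) : Prop :=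
  ∃ a b c d e : V, P.lt a c ∧ P.lt b c ∧ P.lt c d ∧ P.lt c e ∧
    ¬ P.le a b ∧ ¬ P.le b a ∧ ¬ P.le d e ∧ ¬ P.le e d

/-- `G` is an HL-comparability graph: it is the comparability graph of a poset without the X-poset
as a subposet. -/
def IsHLComparabilityGraph {V : Type*} (G : SimpleGraph V) : Prop :=
  ∃ P : PartialOrder V, IsComparabilityGraphOf G P ∧ ¬ HasXSubposet P

/-! ### Koszul filtrations -/

/-! Vertices of the polytope are antichains, that is, sets of maximal elements of lower sets `I` of
the poset. A monomial lies in the ring exactly when no chain has weight above the exponent of `T`.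
Necessity is subadditivity of chain weights. For sufficiency, a monomial of degree `n > 0` has a
level, the lower set of elements where a chain of weight at least `n` starts, and the generator of
the level can be split off (`IsToricExponent.exists_eq_add`).

Multiplication can only shrink the level, and multiplying by the generator of `I` produces level `I`
exactly when `I` was contained in the old level. So a down-closed family `s` of lower sets generates
the ideal of the monomials of positive degree with level in `s`. If `I ∉ s` but every `J < I` is in
`s`, the colon of this ideal by the generator of `I` is generated by the `J` with `¬ I ≤ J`
(`add_lowerSetExponent_mem_idealExponents_iff`). These again form a down-closed family, so along a
linear extension of inclusion the down-closed families are a Koszul filtration.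

Such a filtration yields a linear resolution, because the syzygies of a linear sequence are
generated by another linear sequence (`IsLinearSequence.exists_syzygies`). -/

section KoszulFiltration

variable {k R : Type*} [Field k] [CommRing R] [Algebra k R]

/-- A family `F` of subsets of a linearly ordered set of elements `x i` of `R` is a Koszul
filtration if for all `i ∈ S ∈ F` the colon ideal `(x j : j ∈ S, j < i) : x i` is generated by
the `x j` with `j` in some member of `F`. -/
def IsKoszulFiltration {ι : Type*} [LinearOrder ι] (x : ι → R) (F : Set (Set ι)) : Prop :=
  ∀ S ∈ F, ∀ i ∈ S, ∃ T ∈ F, ∀ a : R,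
    a * x i ∈ Ideal.span (x '' {j | j ∈ S ∧ j < i}) ↔ a ∈ Ideal.span (x '' T)

/-- A sequence of vectors of linear forms, such that every colon ideal of a vector modulo the
previous ones is generated by the `x j` with `j` in some member of `F`. -/
structure IsLinearSequence (𝒜 : ℕ → Submodule k R) {ι : Type*} (x : ι → R) (F : Set (Set ι))
    {κ β : Type*} [LinearOrder κ] (v : κ → β → R) : Prop where
  mem_one : ∀ j l, v j l ∈ 𝒜 1
  colon : ∀ j, ∃ T ∈ F, ∀ a : R,
    a • v j ∈ Submodule.span R (v '' Set.Iio j) ↔ a ∈ Ideal.span (x '' T)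

lemma IsLinearSequence.comp_orderIso {𝒜 : ℕ → Submodule k R} {ι : Type*} {x : ι → R}
    {F : Set (Set ι)} {κ κ' β : Type*} [LinearOrder κ] [LinearOrder κ'] {v : κ → β → R}
    (h : IsLinearSequence 𝒜 x F v) (e : κ' ≃o κ) : IsLinearSequence 𝒜 x F (v ∘ e) where
  mem_one j l := h.mem_one _ _
  colon j := by
    have := h.colon (e j)
    rwa [← e.image_Iio, Set.image_image] at this

/-- If a linear combination of vectors of linear forms is quadratic, then the coefficients may be
chosen to be linear. -/
lemma exists_linear_coeff (𝒜 : ℕ → Submodule k R) [GradedAlgebra 𝒜] {κ β : Type*} [Fintype κ]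
    [LinearOrder κ] {v : κ → β → R} (hv : ∀ j l, v j l ∈ 𝒜 1) {w : β → R} (hw : ∀ l, w l ∈ 𝒜 2)
    {j : κ} (h : w ∈ Submodule.span R (v '' Set.Iio j)) :
    ∃ c : κ → R, (∀ i, c i ∈ 𝒜 1) ∧ (∀ i, j ≤ i → c i = 0) ∧ ∑ i, c i • v i = w := by
  classical
  obtain ⟨c, hc, hcw⟩ : ∃ c : κ → R, (∀ i, j ≤ i → c i = 0) ∧ ∑ i, c i • v i = w := by
    rw [Finsupp.mem_span_image_iff_linearCombination] at h
    obtain ⟨l, hl, rfl⟩ := h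
    refine ⟨l, fun i hi => ?_, ?_⟩
    · by_contra hne
      exact absurd (hl (Finsupp.mem_support_iff.2 hne)) (not_lt.2 hi)
    · rw [Finsupp.linearCombination_apply, Finsupp.sum_fintype _ _ (by simp)]
  -- Taking degree-two parts of the relation keeps only the degree-one part of each coefficient,
  -- since the `v i` are linear.
  refine ⟨fun i => DirectSum.decompose 𝒜 (c i) 1, fun i => SetLike.coe_mem _, fun i hi => ?_, ?_⟩
  · simp [hc i hi]
  · ext l
    have h2 := DirectSum.decompose_of_mem_same 𝒜 (hw l)
    rw [← hcw] at h2 ⊢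
    simp only [Finset.sum_apply, Pi.smul_apply, smul_eq_mul] at h2 ⊢
    rw [← h2]
    refine Eq.trans ?_ (map_sum (GradedRing.proj 𝒜 2) _ _).symm
    exact Finset.sum_congr rfl fun i _ =>
      (DirectSum.coe_decompose_mul_add_of_right_mem 𝒜 (i := 1) (hv i l)).symm

/-- A Gröbner-type argument: the possible last entries of syzygies ending in position `j` form the
`j`-th colon ideal. This is generated by variables `x α`, and each of them lifts to a linear syzygy.
Ordered by position and then by `α`, the lifts have as colon ideals those of the filtration itself.
-/
lemma IsLinearSequence.exists_syzygies (𝒜 : ℕ → Submodule k R) [GradedAlgebra 𝒜] {ι : Type*}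
    [LinearOrder ι] [Finite ι] {x : ι → R} (hx : ∀ i, x i ∈ 𝒜 1) {F : Set (Set ι)}
    (hF : IsKoszulFiltration x F) {r b : ℕ} {v : Fin r → Fin b → R}
    (h : IsLinearSequence 𝒜 x F v) :
    ∃ (r' : ℕ) (v' : Fin r' → Fin r → R), IsLinearSequence 𝒜 x F v' ∧
      Submodule.span R (Set.range v') = LinearMap.ker (Fintype.linearCombination R v) := by
  classical
  choose T hTF hT using h.colon
  -- The relation `x α • v j ∈ span` of earlier vectors is quadratic, so its coefficients can be
  -- taken linear. Membership in `T j` sits inside the existential to make `c` a total function.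
  have hc : ∀ (j : Fin r) (α : ι), ∃ c : Fin r → R, α ∈ T j →
      (∀ i, c i ∈ 𝒜 1) ∧ (∀ i, j ≤ i → c i = 0) ∧ ∑ i, c i • v i = x α • v j := by
    intro j α
    by_cases hα : α ∈ T j
    · obtain ⟨c, hc⟩ := exists_linear_coeff 𝒜 h.mem_one (w := x α • v j)
        (fun l => SetLike.mul_mem_graded (hx α) (h.mem_one j l))
        ((hT j _).2 (Ideal.subset_span ⟨α, hα, rfl⟩))
      exact ⟨c, fun _ => hc⟩
    · exact ⟨0, fun h => absurd h hα⟩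
  choose c hc using hc
  let κ := {p : Fin r ×ₗ ι // (ofLex p).2 ∈ T (ofLex p).1}
  let s : κ → Fin r → R := fun p =>
    Pi.single (ofLex p.1).1 (x (ofLex p.1).2) - c (ofLex p.1).1 (ofLex p.1).2
  let mk : ∀ (j : Fin r) (α : ι), α ∈ T j → κ := fun j α hα => ⟨toLex (j, α), hα⟩
  have hs_self : ∀ j α hα, s (mk j α hα) j = x α := fun j α hα => by
    simp [s, mk, (hc j α hα).2.1 j le_rfl]
  have hs_gt : ∀ j α hα i, j < i → s (mk j α hα) i = 0 := fun j α hα i hi => by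
    simp [s, mk, (hc j α hα).2.1 i hi.le, hi.ne']
  have hs_ker : ∀ p, Fintype.linearCombination R v (s p) = 0 := by
    rintro ⟨p, hp⟩
    have := (hc _ _ hp).2.2
    simp only [s, map_sub, Fintype.linearCombination_apply_single]
    rw [Fintype.linearCombination_apply, this, sub_self]
  have hs_mem : ∀ p l, s p l ∈ 𝒜 1 := by
    rintro ⟨p, hp⟩ l
    refine Submodule.sub_mem _ ?_ ((hc _ _ hp).1 l)
    by_cases hl : l = (ofLex p).1
    · subst hl; simpa using hx _
    · simp [hl]
  -- Elimination from the last position: the last entry of a syzygy lies in a colon ideal, so a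
  -- combination of the `s p` cancels it.
  have hgen : ∀ (m : ℕ) (u : Fin r → R), Fintype.linearCombination R v u = 0 →
      (∀ i : Fin r, m ≤ i → u i = 0) →
      u ∈ Submodule.span R (s '' {p | ((ofLex p.1).1 : ℕ) < m}) := by
    intro m
    induction m with
    | zero =>
      intro u _ hu
      rw [show u = 0 from funext fun i => hu i (Nat.zero_le _)]
      exact zero_mem _
    | succ m ih =>
      intro u huker hu
      have hmono : Submodule.span R (s '' {p | ((ofLex p.1).1 : ℕ) < m}) ≤
          Submodule.span R (s '' {p | ((ofLex p.1).1 : ℕ) < m + 1}) :=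
        Submodule.span_mono (Set.image_mono fun p hp => Nat.lt_succ_of_lt hp)
      by_cases hm : m < r
      · have hum : u ⟨m, hm⟩ ∈ Ideal.span (x '' T ⟨m, hm⟩) := by
          rw [← hT, ← Submodule.neg_mem_iff]
          have h1 : -(u ⟨m, hm⟩ • v ⟨m, hm⟩) = ∑ i ∈ Finset.univ.erase ⟨m, hm⟩, u i • v i := by
            rw [neg_eq_iff_add_eq_zero,
              Finset.add_sum_erase _ (fun i => u i • v i) (Finset.mem_univ _)]
            exact huker
          rw [h1]
          refine Submodule.sum_mem _ fun i hi => ?_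
          rcases lt_or_ge i ⟨m, hm⟩ with hlt | hge
          · exact Submodule.smul_mem _ _ (Submodule.subset_span ⟨i, hlt, rfl⟩)
          · rw [hu i (Fin.lt_def.1 (lt_of_le_of_ne hge (Finset.ne_of_mem_erase hi).symm)),
              zero_smul]
            exact zero_mem _
        obtain ⟨g, hg, hgm⟩ : ∃ g ∈ Submodule.span R
            (s '' {p | ((ofLex p.1).1 : ℕ) < m + 1}),
            Fintype.linearCombination R v g = 0 ∧ (∀ i : Fin r, m + 1 ≤ i → g i = 0) ∧
            g ⟨m, hm⟩ = u ⟨m, hm⟩ := by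
          clear huker hu
          generalize u ⟨m, hm⟩ = y at hum
          induction hum using Submodule.span_induction with
          | mem y hy =>
            obtain ⟨α, hα, rfl⟩ := hy
            exact ⟨s (mk _ α hα), Submodule.subset_span ⟨_, Nat.lt_succ_self m, rfl⟩, hs_ker _,
              fun i hi => hs_gt _ _ hα i hi, hs_self _ _ hα⟩
          | zero => exact ⟨0, zero_mem _, by simp⟩
          | add y z _ _ hy hz =>
            obtain ⟨g, hg, h1, h2, h3⟩ := hy
            obtain ⟨g', hg', h1', h2', h3'⟩ := hz
            exact ⟨g + g', add_mem hg hg', by simp [h1, h1'],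
              fun i hi => by simp [h2 i hi, h2' i hi], by simp [h3, h3']⟩
          | smul a y _ hy =>
            obtain ⟨g, hg, h1, h2, h3⟩ := hy
            exact ⟨a • g, Submodule.smul_mem _ _ hg, by simp [h1],
              fun i hi => by simp [h2 i hi], by simp [h3]⟩
        rw [← sub_add_cancel u g]
        refine add_mem (hmono (ih _ (by simp [huker, hgm.1]) fun i hi => ?_)) hg
        rcases hi.eq_or_lt with heq | hlt
        · rw [show i = ⟨m, hm⟩ from Fin.ext heq.symm, Pi.sub_apply, hgm.2.2, sub_self]
        · rw [Pi.sub_apply, hu i hlt, hgm.2.1 i hlt, sub_zero]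
      · exact hmono (ih u huker fun i hi => absurd i.2 (by omega))
  have hlin : IsLinearSequence 𝒜 x F s := by
    refine ⟨hs_mem, ?_⟩
    rintro ⟨p, hp⟩
    obtain ⟨j, α, rfl⟩ : ∃ j α, p = toLex (j, α) := ⟨_, _, rfl⟩
    change α ∈ T j at hp
    obtain ⟨T', hT'F, hT'⟩ := hF (T j) (hTF j) α hp
    refine ⟨T', hT'F, fun a => ?_⟩
    rw [← hT']
    have hlt : ∀ i β hβ, mk i β hβ < mk j α hp ↔ i < j ∨ i = j ∧ β < α := fun i β hβ =>
      Prod.Lex.toLex_lt_toLex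
    constructor
    · intro ha
      -- Only the `j`-th entry matters: earlier positions contribute `0` there, and position `j`
      -- itself contributes `x β` with `β < α`.
      have h1 : ∀ w ∈ Submodule.span R (s '' Set.Iio (mk j α hp)),
          w j ∈ Ideal.span (x '' {β | β ∈ T j ∧ β < α}) := by
        intro w hw
        induction hw using Submodule.span_induction with
        | mem w hw =>
          obtain ⟨⟨q, hq⟩, hqlt, rfl⟩ := hw
          obtain ⟨i, β, rfl⟩ : ∃ i β, q = toLex (i, β) := ⟨_, _, rfl⟩
          rcases (hlt i β hq).1 hqlt with hij | ⟨rfl, hβ⟩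
          · have := hs_gt i β hq j hij
            exact this ▸ zero_mem _
          · have := hs_self i β hq
            exact this ▸ Ideal.subset_span ⟨β, ⟨hq, hβ⟩, rfl⟩
        | zero => exact zero_mem _
        | add w w' _ _ hw hw' => exact add_mem hw hw'
        | smul a w _ hw => exact Ideal.mul_mem_left _ a hw
      have h2 := h1 _ ha
      have h3 := hs_self j α hp
      change a * s (mk j α hp) j ∈ _ at h2
      rwa [h3] at h2
    · intro ha
      -- A combination `g` of earlier lifts with the same entry `a * x α` in position `j`; then `a •
      -- s - g` is a syzygy ending before `j`, to which `hgen` applies.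
      obtain ⟨g, hg, hg1, hg2, hg3⟩ : ∃ g ∈ Submodule.span R (s '' Set.Iio (mk j α hp)),
          Fintype.linearCombination R v g = 0 ∧ (∀ i, j < i → g i = 0) ∧ g j = a * x α := by
        generalize a * x α = y at ha
        induction ha using Submodule.span_induction with
        | mem y hy =>
          obtain ⟨β, hβ, rfl⟩ := hy
          exact ⟨s (mk j β hβ.1), Submodule.subset_span ⟨_, (hlt _ _ _).2 (.inr ⟨rfl, hβ.2⟩), rfl⟩,
            hs_ker _, fun i hi => hs_gt _ _ hβ.1 i hi, hs_self _ _ hβ.1⟩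
        | zero => exact ⟨0, zero_mem _, by simp⟩
        | add y z _ _ hy hz =>
          obtain ⟨g, hg, h1, h2, h3⟩ := hy
          obtain ⟨g', hg', h1', h2', h3'⟩ := hz
          exact ⟨g + g', add_mem hg hg', by simp [h1, h1'],
            fun i hi => by simp [h2 i hi, h2' i hi], by simp [h3, h3']⟩
        | smul a y _ hy =>
          obtain ⟨g, hg, h1, h2, h3⟩ := hy
          exact ⟨a • g, Submodule.smul_mem _ _ hg, by simp [h1],
            fun i hi => by simp [h2 i hi], by simp [h3]⟩
      change a • s (mk j α hp) ∈ Submodule.span R (s '' Set.Iio (mk j α hp))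
      rw [← sub_add_cancel (a • s (mk j α hp)) g]
      refine add_mem (Submodule.span_mono (Set.image_mono ?_)
        (hgen j _ (by simp [hs_ker, hg1]) fun i hi => ?_)) hg
      · rintro ⟨q, hq⟩ hqj
        exact (hlt (ofLex q).1 (ofLex q).2 hq).2 (.inl hqj)
      · rcases hi.eq_or_lt with heq | hlt'
        · rw [show i = j from Fin.ext heq.symm, Pi.sub_apply, Pi.smul_apply, hs_self, hg3,
            smul_eq_mul, sub_self]
        · rw [Pi.sub_apply, Pi.smul_apply, hs_gt _ _ _ _ hlt', hg2 _ hlt', smul_zero, sub_zero]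
  have : Finite (Fin r ×ₗ ι) := inferInstanceAs (Finite (Fin r × ι))
  have := Fintype.ofFinite κ
  let e : Fin (Fintype.card κ) ≃o κ := (Fintype.orderIsoFinOfCardEq κ rfl)
  refine ⟨_, s ∘ e, hlin.comp_orderIso e, ?_⟩
  rw [e.surjective.range_comp]
  apply le_antisymm
  · rw [Submodule.span_le]
    rintro _ ⟨p, rfl⟩
    exact hs_ker p
  · intro u hu
    exact Submodule.span_mono (Set.image_subset_range _ _)
      (hgen r u hu fun i hi => absurd i.2 (not_lt.2 hi))

/-- A stage in the construction of a linear resolution from a Koszul filtration. -/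
structure LinearStage (𝒜 : ℕ → Submodule k R) {ι : Type*} (x : ι → R) (F : Set (Set ι)) where
  rank : ℕ
  card : ℕ
  vec : Fin card → Fin rank → R
  isLinearSequence : IsLinearSequence 𝒜 x F vec

/-- The generators, viewed as vectors of length one, form a linear sequence spanning the irrelevant
ideal. Iterating the syzygy construction from there gives all differentials. -/
lemma isKoszul_of_isKoszulFiltration (𝒜 : ℕ → Submodule k R) [GradedAlgebra 𝒜] [Nontrivial R]
    (h0 : 𝒜 0 = 1) {ι : Type*} [LinearOrder ι] [Finite ι] {x : ι → R} (hx : ∀ i, x i ∈ 𝒜 1)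
    {F : Set (Set ι)} (hF : IsKoszulFiltration x F) (huniv : Set.univ ∈ F)
    (hirr : (HomogeneousIdeal.irrelevant 𝒜).toIdeal = Ideal.span (Set.range x)) :
    IsKoszul 𝒜 := by
  classical
  refine ⟨inferInstance, h0, ?_⟩
  have := Fintype.ofFinite ι
  let e : Fin (Fintype.card ι) ≃o ι := Fintype.orderIsoFinOfCardEq ι rfl
  have hspan : ∀ (s : Set ι) (w : Fin 1 → R),
      w ∈ Submodule.span R ((fun i => (fun _ => x i : Fin 1 → R)) '' s) ↔
        w 0 ∈ Ideal.span (x '' s) := by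
    intro s w
    let E : R ≃ₗ[R] (Fin 1 → R) := (LinearEquiv.funUnique (Fin 1) R R).symm
    have h1 : (fun i => (fun _ => x i : Fin 1 → R)) '' s = E '' (x '' s) := by
      rw [Set.image_image]; rfl
    have h2 : w = E (w 0) := by
      ext l; rw [Subsingleton.elim l 0]; rfl
    rw [h1, show E '' (x '' s) = E.toLinearMap '' (x '' s) from rfl, ← Submodule.map_span]
    nth_rewrite 1 [h2]
    exact E.injective.mem_set_image
  have hs0 : IsLinearSequence 𝒜 x F (fun i : ι => (fun _ => x i : Fin 1 → R)) := by
    refine ⟨fun j _ => hx j, fun j => ?_⟩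
    obtain ⟨T, hT, h⟩ := hF _ huniv j (Set.mem_univ j)
    refine ⟨T, hT, fun a => ?_⟩
    rw [hspan, ← h]
    simp [Set.Iio]
  let s0 : LinearStage 𝒜 x F := ⟨1, _, _, hs0.comp_orderIso e⟩
  let next : LinearStage 𝒜 x F → LinearStage 𝒜 x F := fun s =>
    ⟨s.card, _, _, (s.isLinearSequence.exists_syzygies 𝒜 hx hF).choose_spec.choose_spec.1⟩
  have hnext : ∀ s, Submodule.span R (Set.range (next s).vec) =
      LinearMap.ker (Fintype.linearCombination R s.vec) := fun s =>
    (s.isLinearSequence.exists_syzygies 𝒜 hx hF).choose_spec.choose_spec.2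
  let S : ℕ → LinearStage 𝒜 x F := fun i => Nat.rec s0 (fun _ s => next s) i
  let ε : (Fin 1 → R) →ₗ[R] R ⧸ (HomogeneousIdeal.irrelevant 𝒜).toIdeal :=
    (Submodule.mkQ _).comp (LinearMap.proj 0)
  refine ⟨fun i => (S i).rank, fun i => Fintype.linearCombination R (S i).vec, ε, ?_, ?_, ?_, ?_,
    ?_⟩
  · intro j
    refine ⟨1, SetLike.one_mem_graded 𝒜, ?_⟩
    have : (Pi.single j 1 : Fin 1 → R) 0 = 1 := by
      have : j = (0 : Fin 1) := Subsingleton.elim (α := Fin 1) _ _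
      subst this
      exact Pi.single_eq_same (M := fun _ : Fin 1 => R) 0 1
    change _ = Submodule.Quotient.mk ((Pi.single j 1 : Fin 1 → R) 0)
    rw [this]
    rfl
  · intro i j l
    have : Fintype.linearCombination R (S i).vec (Pi.single j 1) = (S i).vec j := by
      rw [Fintype.linearCombination_apply_single, one_smul]
    exact this ▸ (S i).isLinearSequence.mem_one j l
  · intro y
    obtain ⟨a, rfl⟩ := Submodule.mkQ_surjective _ y
    exact ⟨fun _ => a, rfl⟩
  · rw [LinearMap.exact_iff, Fintype.range_linearCombination]
    ext w
    change ε w = 0 ↔ w ∈ Submodule.span R (Set.range ((fun i => (fun _ => x i : Fin 1 → R)) ∘ e))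
    rw [e.surjective.range_comp, ← Set.image_univ, hspan, Set.image_univ, ← hirr]
    exact Submodule.Quotient.mk_eq_zero _
  · intro i
    rw [LinearMap.exact_iff, ← hnext (S i)]
    exact (Fintype.range_linearCombination R (v := (next (S i)).vec)).symm

end KoszulFiltration

/-! ### Weights of chains in a finite poset -/

section ChainWeight

variable {V : Type*} [PartialOrder V] [Fintype V]

open Classical in
/-- The largest weight, with respect to `a`, of a chain with smallest element `v`. -/
noncomputable def chainWeight (a : V → ℕ) (v : V) : ℕ :=
  a v + Finset.univ.sup fun w : {w // v < w} => chainWeight a w.1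
termination_by (wellFounded_gt (α := V)).wrap v
decreasing_by exact w.2

lemma add_chainWeight_le (a : V → ℕ) {v w : V} (h : v < w) :
    a v + chainWeight a w ≤ chainWeight a v := by
  classical
  rw [chainWeight.eq_def a v]
  exact Nat.add_le_add_left
    (Finset.le_sup (f := fun w : {w // v < w} => chainWeight a w.1) (Finset.mem_univ ⟨w, h⟩)) _

lemma le_chainWeight (a : V → ℕ) (v : V) : a v ≤ chainWeight a v := by
  rw [chainWeight]
  exact Nat.le_add_right _ _

lemma chainWeight_antitone (a : V → ℕ) : Antitone (chainWeight a) := by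
  intro v w h
  rcases h.eq_or_lt with rfl | h
  · exact le_rfl
  · exact (Nat.le_add_left _ _).trans (add_chainWeight_le a h)

lemma chainWeight_le_add {a : V → ℕ} {v : V} {n : ℕ} (h : ∀ w, v < w → chainWeight a w ≤ n) :
    chainWeight a v ≤ a v + n := by
  rw [chainWeight]
  exact Nat.add_le_add_left (Finset.sup_le fun w _ => h w.1 w.2) _

/-- The weight of a heaviest chain starting at `v` is attained at `v` or continues above `v`. -/
lemma chainWeight_eq_or (a : V → ℕ) (v : V) :
    chainWeight a v = a v ∨ ∃ w, v < w ∧ chainWeight a v = a v + chainWeight a w := by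
  classical
  by_cases h : ∃ w, v < w
  · obtain ⟨w, hw⟩ := h
    obtain ⟨u, -, hu⟩ := Finset.exists_mem_eq_sup (Finset.univ : Finset {w // v < w})
      ⟨⟨w, hw⟩, Finset.mem_univ _⟩ (fun w => chainWeight a w.1)
    refine .inr ⟨u.1, u.2, ?_⟩
    rw [chainWeight.eq_def a v, hu]
  · refine .inl (le_antisymm ?_ (le_chainWeight a v))
    exact chainWeight_le_add (n := 0) fun w hw => absurd ⟨w, hw⟩ h

lemma chainWeight_zero (v : V) : chainWeight (0 : V → ℕ) v = 0 := by
  induction v using WellFoundedGT.induction with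
  | ind v ih => exact Nat.le_zero.1 (chainWeight_le_add (a := 0) fun w hw => (ih w hw).le)

lemma chainWeight_mono {a b : V → ℕ} (h : a ≤ b) (v : V) : chainWeight a v ≤ chainWeight b v := by
  induction v using WellFoundedGT.induction with
  | ind v ih =>
    rcases chainWeight_eq_or a v with hv | ⟨w, hw, hv⟩
    · exact hv ▸ (h v).trans (le_chainWeight b v)
    · rw [hv]
      exact (Nat.add_le_add (h v) (ih w hw)).trans (add_chainWeight_le b hw)

lemma chainWeight_add_le (a b : V → ℕ) (v : V) :
    chainWeight (a + b) v ≤ chainWeight a v + chainWeight b v := by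
  induction v using WellFoundedGT.induction with
  | ind v ih =>
    rcases chainWeight_eq_or (a + b) v with hv | ⟨w, hw, hv⟩
    · exact hv ▸ Nat.add_le_add (le_chainWeight a v) (le_chainWeight b v)
    · have h1 := ih w hw
      have h2 := add_chainWeight_le a hw
      have h3 := add_chainWeight_le b hw
      rw [hv, Pi.add_apply]
      omega

open Classical in
/-- The indicator function of the set of maximal elements of a lower set. -/
noncomputable def maxIndicator (I : LowerSet V) (v : V) : ℕ := if Maximal (· ∈ I) v then 1 else 0

lemma chainWeight_maxIndicator_of_notMem {I : LowerSet V} {v : V} (hv : v ∉ I) :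
    chainWeight (maxIndicator I) v = 0 := by
  induction v using WellFoundedGT.induction with
  | ind v ih =>
    have h0 : maxIndicator I v = 0 := if_neg fun h => hv h.prop
    have := chainWeight_le_add (a := maxIndicator I) (v := v) (n := 0)
      fun w hw => (ih w hw fun h => hv (I.lower hw.le h)).le
    omega

/-- A chain meets the antichain of maximal elements at most once. -/
lemma chainWeight_maxIndicator_le_one (I : LowerSet V) (v : V) :
    chainWeight (maxIndicator I) v ≤ 1 := by
  induction v using WellFoundedGT.induction with
  | ind v ih =>
    by_cases hv : Maximal (· ∈ I) v
    · have h1 : maxIndicator I v = 1 := if_pos hv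
      have := chainWeight_le_add (a := maxIndicator I) (v := v) (n := 0)
        fun w hw => (chainWeight_maxIndicator_of_notMem fun h => hv.not_gt h hw).le
      omega
    · have h0 : maxIndicator I v = 0 := if_neg hv
      have := chainWeight_le_add (a := maxIndicator I) (v := v) (n := 1) fun w hw => ih w hw
      omega

lemma exists_maximal_ge (I : LowerSet V) {v : V} (hv : v ∈ I) :
    ∃ m, v ≤ m ∧ Maximal (· ∈ I) m :=
  (Set.toFinite {w | w ∈ I}).exists_le_maximal hv

/-- Below a maximal `m` of `I`, a chain can be routed through a heaviest chain at `m`, which gains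
one at its starting point. -/
lemma lt_chainWeight_add_maxIndicator {I : LowerSet V} {a : V → ℕ} {n : ℕ}
    (h : ∀ v ∈ I, n ≤ chainWeight a v) {v : V} (hv : v ∈ I) :
    n < chainWeight (a + maxIndicator I) v := by
  obtain ⟨m, hvm, hm⟩ := exists_maximal_ge I hv
  have h1 : maxIndicator I m = 1 := if_pos hm
  refine lt_of_lt_of_le ?_ (chainWeight_antitone _ hvm)
  refine (h m hm.prop).trans_lt ?_
  rcases chainWeight_eq_or a m with hv | ⟨w, hw, hv⟩
  · have := le_chainWeight (a + maxIndicator I) m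
    rw [Pi.add_apply] at this
    omega
  · have h2 := add_chainWeight_le (a + maxIndicator I) hw
    have h3 := chainWeight_mono (a := a) (b := a + maxIndicator I)
      (fun _ => Nat.le_add_right _ _) w
    rw [Pi.add_apply] at h2
    omega

/-- The lower set of all elements that are the smallest element of a chain of weight `≥ n`. -/
def chainLevel (n : ℕ) (a : V → ℕ) : LowerSet V where
  carrier := {v | n ≤ chainWeight a v}
  lower' _ _ h hv := le_trans hv (chainWeight_antitone a h)

lemma mem_chainLevel {n : ℕ} {a : V → ℕ} {v : V} : v ∈ chainLevel n a ↔ n ≤ chainWeight a v :=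
  Iff.rfl

/-- Strictly above a maximal element of the level, weights are at most `n`, so that element itself
carries positive weight. -/
lemma maxIndicator_chainLevel_le (n : ℕ) (a : V → ℕ) : maxIndicator (chainLevel (n + 1) a) ≤ a := by
  intro v
  by_cases hv : Maximal (· ∈ chainLevel (n + 1) a) v
  · have h1 : maxIndicator (chainLevel (n + 1) a) v = 1 := if_pos hv
    have h2 := mem_chainLevel.1 hv.prop
    have h3 := chainWeight_le_add (a := a) (v := v) (n := n) fun w hw => by
      by_contra hcon
      exact hv.not_gt (mem_chainLevel.2 (by omega)) hw
    exact h1.trans_le (by omega)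
  · exact (if_neg hv).trans_le (Nat.zero_le _)

/-- The greedy step: removing the top of the level lowers every chain of maximal weight. -/
lemma chainWeight_sub_maxIndicator_le {n : ℕ} {a : V → ℕ} (h : ∀ v, chainWeight a v ≤ n + 1)
    (v : V) : chainWeight (a - maxIndicator (chainLevel (n + 1) a)) v ≤ n := by
  set b := maxIndicator (chainLevel (n + 1) a)
  have hle : ∀ w, chainWeight (a - b) w ≤ chainWeight a w :=
    chainWeight_mono fun _ => Nat.sub_le _ _
  induction v using WellFoundedGT.induction with
  | ind v ih =>
    by_cases hmem : v ∈ chainLevel (n + 1) a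
    · by_cases hv : Maximal (· ∈ chainLevel (n + 1) a) v
      · have h1 : b v = 1 := if_pos hv
        have h2 := maxIndicator_chainLevel_le n a v
        change b v ≤ a v at h2
        have h3 := h v
        rcases chainWeight_eq_or (a - b) v with hv | ⟨w, hw, hv⟩
        · have := le_chainWeight a v
          rw [hv, Pi.sub_apply]
          omega
        · have h4 := hle w
          have h5 := add_chainWeight_le a hw
          rw [hv, Pi.sub_apply]
          omega
      -- The weight at `m > v` is already `n + 1`, the largest allowed, so `a v = 0` and the bound
      -- is inherited from above.
      · obtain ⟨m, hvm, hm⟩ := exists_maximal_ge _ hmem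
        have hlt : v < m := lt_of_le_of_ne hvm fun h => hv (h ▸ hm)
        have h1 := mem_chainLevel.1 hm.prop
        have h2 := add_chainWeight_le a hlt
        have h3 := h v
        have h4 := chainWeight_le_add (a := a - b) (v := v) (n := n) ih
        rw [Pi.sub_apply] at h4
        omega
    · have h1 := hle v
      rw [mem_chainLevel] at hmem
      omega

end ChainWeight

/-! ### Exponents of the monomials of the toric ring -/

section Exponent

variable {V : Type*} [PartialOrder V] [Fintype V]

/-- The exponent of the monomial `T · ∏ Xᵥ` with `v` in the set of maximal elements of `I`. -/
noncomputable def lowerSetExponent (I : LowerSet V) : Option V →₀ ℕ :=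
  Finsupp.equivFunOnFinite.symm fun o => o.elim 1 (maxIndicator I)

@[simp] lemma lowerSetExponent_none (I : LowerSet V) : lowerSetExponent I none = 1 := rfl

/-- Exponents all of whose chains have weight at most the exponent of `T`. -/
def IsToricExponent (e : Option V →₀ ℕ) : Prop :=
  ∀ v, chainWeight (fun v => e (some v)) v ≤ e none

/-- The smallest lower set in a factorization of the monomial with exponent `e`. -/
def exponentLevel (e : Option V →₀ ℕ) : LowerSet V :=
  chainLevel (e none) fun v => e (some v)

lemma IsToricExponent.add {e f : Option V →₀ ℕ} (he : IsToricExponent e)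
    (hf : IsToricExponent f) : IsToricExponent (e + f) := fun v =>
  (chainWeight_add_le _ _ v).trans (Nat.add_le_add (he v) (hf v))

lemma isToricExponent_lowerSetExponent (I : LowerSet V) :
    IsToricExponent (lowerSetExponent I) :=
  chainWeight_maxIndicator_le_one I

lemma exponentLevel_add_le (e : Option V →₀ ℕ) {f : Option V →₀ ℕ} (hf : IsToricExponent f) :
    exponentLevel (e + f) ≤ exponentLevel e := by
  intro v hv
  have h1 : e none + f none ≤ chainWeight (fun v => e (some v) + f (some v)) v := hv
  have h2 := chainWeight_add_le (fun v => e (some v)) (fun v => f (some v)) v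
  have h3 := hf v
  change e none ≤ chainWeight (fun v => e (some v)) v
  exact Nat.le_of_add_le_add_right (h1.trans (h2.trans (Nat.add_le_add_left h3 _)))

lemma exponentLevel_add_lowerSetExponent_le {e : Option V →₀ ℕ} (he : IsToricExponent e)
    (I : LowerSet V) : exponentLevel (e + lowerSetExponent I) ≤ I := by
  intro v hv
  by_contra hvI
  have h1 : e none + 1 ≤ chainWeight ((fun v => e (some v)) + maxIndicator I) v := hv
  have h2 := chainWeight_add_le (fun v => e (some v)) (maxIndicator I) v
  rw [chainWeight_maxIndicator_of_notMem hvI] at h2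
  have h3 := he v
  omega

lemma exponentLevel_add_lowerSetExponent {e : Option V →₀ ℕ} (he : IsToricExponent e)
    {I : LowerSet V} (hI : I ≤ exponentLevel e) : exponentLevel (e + lowerSetExponent I) = I :=
  le_antisymm (exponentLevel_add_lowerSetExponent_le he I) fun _ hv =>
    lt_chainWeight_add_maxIndicator (n := e none) (a := fun v => e (some v))
      (fun _ hw => hI hw) hv

lemma IsToricExponent.exists_eq_add {e : Option V →₀ ℕ} (he : IsToricExponent e)
    (h0 : e none ≠ 0) :
    ∃ f, IsToricExponent f ∧ f none + 1 = e none ∧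
      e = f + lowerSetExponent (exponentLevel e) := by
  obtain ⟨n, hn⟩ := Nat.exists_eq_succ_of_ne_zero h0
  have hI : exponentLevel e = chainLevel (n + 1) fun v => e (some v) := by
    rw [exponentLevel, hn]
  have hle := maxIndicator_chainLevel_le n fun v => e (some v)
  refine ⟨e - lowerSetExponent (exponentLevel e), fun v => ?_, ?_, ?_⟩
  · have h := chainWeight_sub_maxIndicator_le (a := fun v => e (some v)) (n := n)
      (fun v => (he v).trans_eq hn) v
    rw [← hI] at h
    exact h.trans_eq (by simp [hn])
  · simp [hn]
  · rw [← hI] at hle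
    refine (tsub_add_cancel_of_le fun o => ?_).symm
    cases o with
    | none => simp [hn]
    | some v => exact hle v

lemma IsToricExponent.eq_zero {e : Option V →₀ ℕ} (he : IsToricExponent e) (h0 : e none = 0) :
    e = 0 := by
  ext o
  cases o with
  | none => exact h0
  | some v => exact Nat.le_zero.1 (((le_chainWeight _ v).trans (he v)).trans_eq h0)

/-- The exponents of the monomials in the ideal generated by the monomials of the lower sets in
`s`. -/
def idealExponents (s : Set (LowerSet V)) : Set (Option V →₀ ℕ) :=
  {e | IsToricExponent e ∧ e none ≠ 0 ∧ exponentLevel e ∈ s}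

lemma add_mem_idealExponents {s : Set (LowerSet V)} (hs : IsLowerSet s) {e f : Option V →₀ ℕ}
    (he : e ∈ idealExponents s) (hf : IsToricExponent f) : f + e ∈ idealExponents s := by
  rw [add_comm]
  refine ⟨he.1.add hf, ?_, hs (exponentLevel_add_le e hf) he.2.2⟩
  have := he.2.1
  rw [Finsupp.add_apply]
  omega

lemma lowerSetExponent_mem_idealExponents {s : Set (LowerSet V)} (hs : IsLowerSet s)
    {I : LowerSet V} (hI : I ∈ s) : lowerSetExponent I ∈ idealExponents s := by
  refine ⟨isToricExponent_lowerSetExponent I, by simp, hs ?_ hI⟩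
  have h0 : IsToricExponent (0 : Option V →₀ ℕ) := fun v =>
    (chainWeight_zero v).le
  simpa using exponentLevel_add_lowerSetExponent_le h0 I

/-- The combinatorial form of the colon ideals. -/
lemma add_lowerSetExponent_mem_idealExponents_iff {s : Set (LowerSet V)} {I : LowerSet V}
    (hI : I ∉ s) (hlt : ∀ J < I, J ∈ s) {e : Option V →₀ ℕ} (he : IsToricExponent e) :
    e + lowerSetExponent I ∈ idealExponents s ↔ e ∈ idealExponents {J | ¬ I ≤ J} := by
  constructor
  · rintro ⟨-, -, h⟩
    have hle : ¬ I ≤ exponentLevel e := fun hle =>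
      hI (exponentLevel_add_lowerSetExponent he hle ▸ h)
    -- In degree zero the level is all of `V`, which contains `I`.
    refine ⟨he, fun h0 => hle fun v _ => ?_, hle⟩
    change e none ≤ _
    exact h0 ▸ Nat.zero_le _
  · rintro ⟨-, -, hle⟩
    refine ⟨he.add (isToricExponent_lowerSetExponent I), by simp, hlt _ ?_⟩
    refine lt_of_le_of_ne (exponentLevel_add_lowerSetExponent_le he I) fun h => hle ?_
    rw [← h]
    exact exponentLevel_add_le e (isToricExponent_lowerSetExponent I)

end Exponent

/-! ### Monomials and monomial ideals of the toric ring -/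

section Ring

variable (k : Type*) [Field k] {V : Type*} [PartialOrder V] [Fintype V]

lemma toricMonomial_maxIndicator (I : LowerSet V) :
    toricMonomial k (maxIndicator I) = MvPolynomial.monomial (lowerSetExponent I) 1 := by
  rw [MvPolynomial.monomial_eq, Finsupp.prod_fintype _ _ (by simp), Fintype.prod_option,
    toricMonomial, map_one, one_mul, lowerSetExponent_none, pow_one]
  rfl

variable {k} {P : Set (V → ℝ)}
  (hP : ∀ a : V → ℕ, (fun v => (a v : ℝ)) ∈ P.extremePoints ℝ ↔ ∃ I : LowerSet V, maxIndicator I = a)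

include hP

lemma monomial_lowerSetExponent_mem_toricRing (I : LowerSet V) :
    MvPolynomial.monomial (lowerSetExponent I) 1 ∈ toricRing k P :=
  Algebra.subset_adjoin ⟨_, (hP _).2 ⟨I, rfl⟩, (toricMonomial_maxIndicator k I).symm⟩

lemma monomial_mem_toricRing {e : Option V →₀ ℕ} (he : IsToricExponent e) (c : k) :
    MvPolynomial.monomial e c ∈ toricRing k P := by
  obtain ⟨n, hn⟩ : ∃ n, e none = n := ⟨_, rfl⟩
  induction n generalizing e with
  | zero =>
    rw [he.eq_zero hn]
    exact (toricRing k P).algebraMap_mem c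
  | succ n ih =>
    obtain ⟨f, hf, hfn, hef⟩ := he.exists_eq_add (by omega)
    rw [hef, ← mul_one c, ← MvPolynomial.monomial_mul]
    exact mul_mem (ih hf (by omega)) (monomial_lowerSetExponent_mem_toricRing hP _)

lemma mem_toricRing_iff {p : MvPolynomial (Option V) k} :
    p ∈ toricRing k P ↔ ∀ e ∈ p.support, IsToricExponent e := by
  classical
  constructor
  · intro hp
    induction hp using Algebra.adjoin_induction with
    | mem p hp =>
      obtain ⟨a, ha, rfl⟩ := hp
      obtain ⟨I, rfl⟩ := (hP a).1 ha
      rw [toricMonomial_maxIndicator]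
      intro e he
      rw [Finset.mem_singleton.1 (MvPolynomial.support_monomial_subset he)]
      exact isToricExponent_lowerSetExponent I
    | algebraMap c =>
      intro e he
      rw [Finset.mem_singleton.1 (MvPolynomial.support_monomial_subset he)]
      exact fun v => (chainWeight_zero v).le
    | add p q _ _ hp hq =>
      intro e he
      exact (Finset.mem_union.1 (MvPolynomial.support_add he)).elim (hp e) (hq e)
    | mul p q _ _ hp hq =>
      intro e he
      obtain ⟨f, hf, g, hg, rfl⟩ := Finset.mem_add.1 (MvPolynomial.support_mul p q he)
      exact (hp f hf).add (hq g hg)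
  · intro h
    rw [p.as_sum]
    exact sum_mem fun e he => monomial_mem_toricRing hP (h e he) _

/-- The generator of the toric ring that belongs to a lower set. -/
noncomputable def toricGenerator (I : LowerSet V) : toricRing k P :=
  ⟨MvPolynomial.monomial (lowerSetExponent I) 1, monomial_lowerSetExponent_mem_toricRing hP I⟩

/-- Down-closedness makes the right-hand condition stable under multiplication; conversely, each
monomial is divisible by the generator of its own level. -/
lemma mem_span_toricGenerator_iff {s : Set (LowerSet V)} (hs : IsLowerSet s)
    {p : toricRing k P} : p ∈ Ideal.span (toricGenerator (k := k) hP '' s) ↔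
      ∀ e ∈ (p : MvPolynomial (Option V) k).support, e ∈ idealExponents s := by
  classical
  constructor
  · intro hp
    induction hp using Submodule.span_induction with
    | mem p hp =>
      obtain ⟨I, hI, rfl⟩ := hp
      intro e he
      rw [Finset.mem_singleton.1 (MvPolynomial.support_monomial_subset he)]
      exact lowerSetExponent_mem_idealExponents hs hI
    | zero => simp
    | add p q _ _ hp hq =>
      intro e he
      exact (Finset.mem_union.1 (MvPolynomial.support_add he)).elim (hp e) (hq e)
    | smul a p _ hp =>
      intro e he
      obtain ⟨f, hf, g, hg, rfl⟩ := Finset.mem_add.1 (MvPolynomial.support_mul a.1 p.1 he)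
      exact add_mem_idealExponents hs (hp g hg) ((mem_toricRing_iff hP).1 a.2 f hf)
  · intro h
    -- The terms of `p` as elements of the ring; the value `0` is never used on the support.
    let m : (Option V →₀ ℕ) → toricRing k P := fun e =>
      if he : IsToricExponent e then
        ⟨MvPolynomial.monomial e (p.1.coeff e), monomial_mem_toricRing hP he _⟩ else 0
    have hp : p = ∑ e ∈ p.1.support, m e := by
      apply Subtype.ext
      rw [AddSubmonoidClass.coe_finsetSum]
      conv_lhs => rw [p.1.as_sum]
      refine Finset.sum_congr rfl fun e he => ?_
      rw [show m e = _ from dif_pos ((mem_toricRing_iff hP).1 p.2 e he)]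
    rw [hp]
    refine Ideal.sum_mem _ fun e he => ?_
    obtain ⟨he1, he2, he3⟩ := h e he
    obtain ⟨f, hf, -, hef⟩ := he1.exists_eq_add he2
    have : m e = ⟨MvPolynomial.monomial f (p.1.coeff e), monomial_mem_toricRing hP hf _⟩ *
        toricGenerator hP (exponentLevel e) := by
      rw [show m e = _ from dif_pos he1]
      apply Subtype.ext
      change _ = MvPolynomial.monomial f _ * MvPolynomial.monomial _ 1
      rw [MvPolynomial.monomial_mul, mul_one, ← hef]
    rw [this]
    exact Ideal.mul_mem_left _ _ (Ideal.subset_span ⟨_, he3, rfl⟩)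

lemma mul_toricGenerator_mem_span_iff {s : Set (LowerSet V)} (hs : IsLowerSet s)
    {I : LowerSet V} (hI : I ∉ s) (hlt : ∀ J < I, J ∈ s) (p : toricRing k P) :
    p * toricGenerator hP I ∈ Ideal.span (toricGenerator (k := k) hP '' s) ↔
      p ∈ Ideal.span (toricGenerator (k := k) hP '' {J | ¬ I ≤ J}) := by
  have hs' : IsLowerSet {J | ¬ I ≤ J} := fun J K hKJ hJ hIK => hJ (hIK.trans hKJ)
  rw [mem_span_toricGenerator_iff hP hs, mem_span_toricGenerator_iff hP hs']
  -- Multiplying by a monomial translates the support, so the colon ideal can be computed exponent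
  -- by exponent.
  have key : ∀ e, (e ∈ p.1.support ↔
      e + lowerSetExponent I ∈ (p * toricGenerator hP I : toricRing k P).1.support) := by
    intro e
    change _ ↔ _ ∈ (p.1 * MvPolynomial.monomial (lowerSetExponent I) 1).support
    rw [MvPolynomial.mem_support_iff, MvPolynomial.mem_support_iff,
      MvPolynomial.coeff_mul_monomial, mul_one]
  have hmul : ∀ e ∈ (p * toricGenerator hP I : toricRing k P).1.support,
      ∃ f, e = f + lowerSetExponent I := by
    classical
    intro e he
    obtain ⟨f, -, g, hg, rfl⟩ := Finset.mem_add.1 (MvPolynomial.support_mul p.1 _ he)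
    rw [Finset.mem_singleton.1 (MvPolynomial.support_monomial_subset hg)]
    exact ⟨f, rfl⟩
  constructor
  · intro h e he
    exact (add_lowerSetExponent_mem_idealExponents_iff hI hlt
      ((mem_toricRing_iff hP).1 p.2 e he)).1 (h _ ((key e).1 he))
  · intro h e he
    obtain ⟨f, rfl⟩ := hmul e he
    have hf := (key f).2 he
    exact (add_lowerSetExponent_mem_idealExponents_iff hI hlt
      ((mem_toricRing_iff hP).1 p.2 f hf)).2 (h f hf)

/-- The sets of lower sets that are closed under passing to smaller lower sets give a Koszul
filtration of the toric ring. -/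
lemma isKoszulFiltration_toricGenerator :
    IsKoszulFiltration (ι := LinearExtension (LowerSet V)) (toricGenerator (k := k) hP)
      {S | IsLowerSet (toLinearExtension ⁻¹' S)} := by
  intro S hS i hi
  obtain ⟨I, rfl⟩ : ∃ I : LowerSet V, toLinearExtension I = i := ⟨i, rfl⟩
  refine ⟨{J : LowerSet V | ¬ I ≤ J}, fun J K hKJ hJ hIK => hJ (hIK.trans hKJ), fun p => ?_⟩
  refine mul_toricGenerator_mem_span_iff hP
    (s := {J | toLinearExtension J ∈ S ∧ toLinearExtension J < toLinearExtension I}) ?_ ?_ ?_ p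
  · exact fun J K hKJ hJ => ⟨hS hKJ hJ.1, (toLinearExtension.monotone hKJ).trans_lt hJ.2⟩
  · exact fun h => lt_irrefl _ h.2
  · exact fun J hJ => ⟨hS hJ.le hi, lt_of_le_of_ne (toLinearExtension.monotone hJ.le) hJ.ne⟩

omit hP [PartialOrder V] in
lemma weight_toricWeight (e : Option V →₀ ℕ) : Finsupp.weight (toricWeight V) e = e none := by
  rw [Finsupp.weight_apply, Finsupp.sum_fintype _ _ (by simp), Fintype.sum_option]
  simp [toricWeight]

lemma toricGrading_zero : toricGrading k P 0 = 1 := by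
  classical
  apply le_antisymm
  · intro p hp
    rw [mem_toricGrading] at hp
    rw [Submodule.mem_one]
    refine ⟨p.1.coeff 0, Subtype.ext ?_⟩
    change MvPolynomial.C (p.1.coeff 0) = p.1
    ext e
    rw [MvPolynomial.coeff_C]
    split_ifs with h
    · rw [h]
    · by_contra hne
      have h0 : p.1.coeff e ≠ 0 := Ne.symm hne
      refine h (((mem_toricRing_iff hP).1 p.2 e (MvPolynomial.mem_support_iff.2 h0)).eq_zero ?_).symm
      rw [← weight_toricWeight, hp h0]
  · rw [Submodule.one_le]
    exact SetLike.one_mem_graded (toricGrading k P)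

lemma toricGenerator_mem (I : LowerSet V) : toricGenerator hP I ∈ toricGrading k P 1 := by
  rw [mem_toricGrading]
  refine MvPolynomial.isWeightedHomogeneous_monomial _ _ _ ?_
  rw [weight_toricWeight, lowerSetExponent_none]

lemma irrelevant_toricGrading :
    (HomogeneousIdeal.irrelevant (toricGrading k P)).toIdeal =
      Ideal.span (Set.range (toricGenerator (k := k) hP)) := by
  ext p
  rw [← Set.image_univ, mem_span_toricGenerator_iff hP isLowerSet_univ]
  change p ∈ HomogeneousIdeal.irrelevant (toricGrading k P) ↔ _
  rw [HomogeneousIdeal.mem_irrelevant_iff, GradedRing.proj_apply]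
  -- The decomposition is only a chosen one, so its components are identified with the weighted
  -- homogeneous components of polynomials.
  have h1 : ((DirectSum.decompose (toricGrading k P) p 0 : toricRing k P) :
      MvPolynomial (Option V) k) =
      MvPolynomial.weightedHomogeneousComponent (toricWeight V) 0 p.1 := by
    rw [← weightedHomogeneousComponent_coeAddMonoidHom]
    congr 2
    exact DirectSum.Decomposition.left_inv p
  constructor
  · intro h e he
    refine ⟨(mem_toricRing_iff hP).1 p.2 e he, fun h0 => ?_, trivial⟩
    rw [h] at h1
    have h2 := congrArg (MvPolynomial.coeff e) h1
    rw [MvPolynomial.coeff_weightedHomogeneousComponent, weight_toricWeight, if_pos h0] at h2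
    exact MvPolynomial.mem_support_iff.1 he h2.symm
  · intro h
    apply Subtype.ext
    rw [h1]
    ext e
    rw [MvPolynomial.coeff_weightedHomogeneousComponent, weight_toricWeight]
    split_ifs with h0
    · by_contra hne
      exact (h e (MvPolynomial.mem_support_iff.2 hne)).2.1 h0
    · rfl

lemma isKoszul_toricRing : IsKoszul (toricGrading k P) := by
  have : Finite (LinearExtension (LowerSet V)) :=
    inferInstanceAs (Finite (LowerSet V))
  exact isKoszul_of_isKoszulFiltration (ι := LinearExtension (LowerSet V)) (toricGrading k P)
    (toricGrading_zero hP)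
    (fun i => toricGenerator_mem hP i) (isKoszulFiltration_toricGenerator hP)
    (fun _ _ _ _ => trivial) (irrelevant_toricGrading hP)

end Ring

/-! ### The vertices of the stable set polytope -/

section Vertices

variable {V : Type*}

/-- The polytope lies in the unit cube, and a `0/1` vector is already extreme there. -/
lemma indicator_mem_extremePoints_stableSetPolytope (G : SimpleGraph V) {S : Set V}
    (hS : G.IsIndepSet S) :
    S.indicator (fun _ => (1 : ℝ)) ∈ (stableSetPolytope G).extremePoints ℝ := by
  have hind : ∀ (T : Set V) (v : V), T.indicator (fun _ => (1 : ℝ)) v ∈ ({0, 1} : Set ℝ) := by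
    intro T v
    by_cases hv : v ∈ T <;> simp [hv]
  have hsub : stableSetPolytope G ⊆ Set.univ.pi fun _ => Set.Icc (0 : ℝ) 1 := by
    refine convexHull_min ?_ (convex_pi fun _ _ => convex_Icc 0 1)
    rintro _ ⟨T, -, rfl⟩ v -
    rcases hind T v with h | h <;> rw [h] <;> simp
  refine inter_extremePoints_subset_extremePoints_of_subset hsub
    ⟨subset_convexHull ℝ _ ⟨S, hS, rfl⟩, ?_⟩
  rw [extremePoints_pi]
  intro v _
  rw [Set.extremePoints_Icc zero_le_one]
  exact hind S v

lemma mem_extremePoints_stableSetPolytope_iff [PartialOrder V] [Fintype V] {G : SimpleGraph V}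
    (hG : ∀ i j : V, G.Adj i j ↔ i ≠ j ∧ (i ≤ j ∨ j ≤ i)) (a : V → ℕ) :
    (fun v => (a v : ℝ)) ∈ (stableSetPolytope G).extremePoints ℝ ↔
      ∃ I : LowerSet V, maxIndicator I = a := by
  have hmax : ∀ I : LowerSet V, (fun v => (maxIndicator I v : ℝ)) =
      {v | Maximal (· ∈ I) v}.indicator (fun _ => (1 : ℝ)) := by
    intro I
    ext v
    by_cases hv : Maximal (· ∈ I) v <;> simp [maxIndicator, hv]
  constructor
  · intro h
    obtain ⟨S, hS, hSa⟩ := extremePoints_convexHull_subset h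
    -- Stable sets are antichains, and an antichain is the set of maximal elements of its lower
    -- closure.
    refine ⟨lowerClosure S, ?_⟩
    have hanti : IsAntichain (· ≤ ·) S := fun i hi j hj hij hle =>
      hS hi hj hij ((hG i j).2 ⟨hij, .inl hle⟩)
    have hS' : {v | Maximal (· ∈ lowerClosure S) v} = S := by
      ext v
      constructor
      · intro hv
        obtain ⟨w, hw, hvw⟩ := hv.prop
        rwa [hv.eq_of_le (subset_lowerClosure hw) hvw]
      · intro hv
        refine ⟨subset_lowerClosure hv, ?_⟩
        rintro w ⟨u, hu, hwu⟩ hvw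
        rwa [hanti.eq hv hu (hvw.trans hwu)]
    have h2 := (hmax (lowerClosure S)).trans (by rw [hS', ← hSa])
    ext v
    exact_mod_cast congrFun h2 v
  · rintro ⟨I, rfl⟩
    rw [hmax]
    refine indicator_mem_extremePoints_stableSetPolytope G fun i hi j hj hij hadj => ?_
    rcases ((hG i j).1 hadj).2 with h | h
    · exact hij (hi.eq_of_le hj.prop h)
    · exact hij (hj.eq_of_le hi.prop h).symm

end Vertices

theorem theorem5p4 (k : Type*) [Field k] {V : Type*} [Fintype V] (G : SimpleGraph V)
    (hG : IsHLComparabilityGraph G) :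
    IsKoszul (toricGrading k (stableSetPolytope G)) := by
  obtain ⟨P, hP, -⟩ := hG
  let _ : PartialOrder V := P
  exact isKoszul_toricRing (mem_extremePoints_stableSetPolytope_iff hP)
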